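/- All Banach spaces are real, $\omega_1$ is the first uncountable ordinal, and products and powers of ordinals are the usual ordinal ones. For a Banach space $X$ with closed unit ball $B_X$ and $\varepsilon>0$, let $\mathcal H^X_\varepsilon$ be the set of all finite sequences $(x_i)_{i=1}^n$ in $B_X$ (including the empty sequence) for which there is $x^*\in B_{X^*}$ with $x^*(x_i)\ge\varepsilon$ for all $1\le i\le n$. For a set $\mathcal H$ of finite sequences in $X$, let $(\mathcal H)'_w$ be the set of those $t\in\mathcal H$ for which there is a weakly null sequence $(s_i)_{i\in\mathbb N}$ in $B_X$ such that each concatenation $t^\frown s_i$ belongs to $\mathcal H$. Put $(\mathcal H)^0_w=\mathcal H$, $(\mathcal H)^{\xi+1}_w=((\mathcal H)^\xi_w)'_w$, and $(\mathcal H)^\xi_w=\bigcap_{\zeta<\xi}(\mathcal H)^\zeta_w$ for limit $\xi$. Let $I_w(\mathcal H)$ be the least $\xi<\omega_1$ with $(\mathcal H)^\xi_w=\varnothing$ if there is one, and $I_w(\mathcal H)=\omega_1$ otherwise. For $\varepsilon>0$ and a bounded set $L\subset X^*$, let $s_\varepsilon(L)$ be the set of all $x^*\in X^*$ such that $\operatorname{diam}_{\|\cdot\|}(V\cap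 L)>\varepsilon$ for every weak$^*$ neighbourhood $V$ of $x^*$. Put $s^0_\varepsilon(L)=L$, $s^{\xi+1}_\varepsilon(L)=s_\varepsilon(s^\xi_\varepsilon(L))$, and $s^\xi_\varepsilon(L)=\bigcap_{\zeta<\xi}s^\zeta_\varepsilon(L)$ for limit $\xi$. Let $Sz_\varepsilon(L)$ be the least $\xi<\omega_1$ with $s^\xi_\varepsilon(L)=\varnothing$ if there is one, and $Sz_\varepsilon(L)=\omega_1$ otherwise. Put $Sz(X)=\sup_{\varepsilon>0}Sz_\varepsilon(B_{X^*})$. **Theorem.** (1) Let $X$ be a Banach space with separable dual, $Y$ a closed subspace of $X$, and $\varepsilon\in(0,1/3)$. Then $$I_w(\mathcal H^X_\varepsilon)\le I_w(\mathcal H^{X/Y}_{\varepsilon/5})\, I_w(\mathcal H^Y_{\varepsilon/5}).$$ (2) For every ordinal $\xi<\omega_1$, both "$Sz(\cdot)\le\omega^{\omega^\xi}$" and "$Sz(\cdot)<\omega^{\omega^\xi}$" are three-space properties on the class of separable Banach spaces: if $X$ is a separable Banach space, $Y$ is a closed subspace of $X$, and both $Y$ and $X/Y$ have the property, then $X$ has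 it. -/

import Mathlib

open scoped Ordinal

universe u

noncomputable section

namespace SzlenkIndex

/-- The transfinite iterates of a derivation `D` of subsets of `α`, started at `L`:
`L` at `0`, one application of `D` at successors, and intersections at limit ordinals. -/
def iter {α : Type*} (D : Set α → Set α) (L : Set α) (ξ : Ordinal.{0}) : Set α :=
  Ordinal.limitRecOn (motive := fun _ => Set α) ξ L (fun _ S => D S)
    (fun ξ _ S => ⋂ (ζ : Ordinal.{0}) (h : ζ < ξ), S ζ h)

theorem iter_zero {α : Type*} (D : Set α → Set α) (L : Set α) : iter D L 0 = L :=
  Ordinal.limitRecOn_zero ..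

theorem iter_add_one {α : Type*} (D : Set α → Set α) (L : Set α) (ξ : Ordinal.{0}) :
    iter D L (ξ + 1) = D (iter D L ξ) :=
  Ordinal.limitRecOn_add_one ..

theorem iter_limit {α : Type*} (D : Set α → Set α) (L : Set α) (ξ : Ordinal.{0})
    (h : Order.IsSuccLimit ξ) : iter D L ξ = ⋂ (ζ : Ordinal.{0}) (_ : ζ < ξ), iter D L ζ :=
  Ordinal.limitRecOn_limit _ _ _ _ h

/-- The index of a derivation: the least countable `ξ` for which the `ξ`-th iterate is empty,
and `ω₁` if there is no such countable `ξ`. -/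
def index {α : Type*} (D : Set α → Set α) (L : Set α) : Ordinal.{0} :=
  sInf (insert ω₁ {ξ : Ordinal.{0} | ξ < ω₁ ∧ iter D L ξ = ∅})

section Szlenk

variable {X : Type*} [NormedAddCommGroup X] [NormedSpace ℝ X]

/-- The Szlenk derivation: the functionals `f` all of whose weak-star neighbourhoods `V` satisfy
`diam (V ∩ L) > ε`, the diameter being taken in the dual norm. -/
def szlenkDerivative (ε : ℝ) (L : Set (StrongDual ℝ X)) : Set (StrongDual ℝ X) :=
  {f | ∀ V ∈ nhds (StrongDual.toWeakDual f),
    ENNReal.ofReal ε < Metric.ediam (StrongDual.toWeakDual ⁻¹' V ∩ L)}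

/-- `Sz_ε(L)`. -/
def szlenkIndexAt (ε : ℝ) (L : Set (StrongDual ℝ X)) : Ordinal.{0} :=
  index (szlenkDerivative ε) L

/-- `Sz(L) = sup_{ε > 0} Sz_ε(L)`. -/
def szlenkIndexOf (L : Set (StrongDual ℝ X)) : Ordinal.{0} :=
  ⨆ ε : Set.Ioi (0 : ℝ), szlenkIndexAt (ε : ℝ) L

variable (X) in
/-- The Szlenk index `Sz(X)` of a space is that of its closed dual unit ball. -/
def Sz : Ordinal.{0} :=
  szlenkIndexOf (Metric.closedBall (0 : StrongDual ℝ X) 1)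

end Szlenk

/-- For a family `σ` of infinite sequences in `S`, the `σ`-derivation of a set `H` of finite
sequences keeps those `t ∈ H` for which all the one-step extensions `t ⌢ s i`, for some
sequence `s` in `σ`, lie in `H`. -/
def sigmaDerivative {S : Type*} (σ : Set (ℕ → S)) (H : Set (List S)) : Set (List S) :=
  {t ∈ H | ∃ s ∈ σ, ∀ i, t ++ [s i] ∈ H}

section WeaklyNull

variable (X : Type*) [NormedAddCommGroup X] [NormedSpace ℝ X]

/-- The weakly null sequences in the closed unit ball of `X`. -/
def weaklyNull : Set (ℕ → X) :=
  {s | (∀ i, ‖s i‖ ≤ 1) ∧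
    ∀ f : StrongDual ℝ X, Filter.Tendsto (fun i => f (s i)) Filter.atTop (nhds 0)}

/-- `H^X_ε`: the finite sequences (the empty one included) in the closed unit ball of `X` on all
of whose terms some functional of norm at most one takes values at least `ε`. -/
def H (ε : ℝ) : Set (List X) :=
  {l | (∀ x ∈ l, ‖x‖ ≤ 1) ∧ ∃ f : StrongDual ℝ X, ‖f‖ ≤ 1 ∧ ∀ x ∈ l, ε ≤ f x}

variable {X} in
/-- The weakly null index `I_w` of a set of finite sequences in `X`. -/
def Iw (T : Set (List X)) : Ordinal.{0} :=
  index (sigmaDerivative (weaklyNull X)) T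

end WeaklyNull

/-- `P` is a three-space property on the class of separable Banach spaces: a separable Banach
space `X` has `P` as soon as, for some closed subspace `Y` of `X`, both `Y` and `X / Y` have
`P`. -/
def IsThreeSpaceProperty
    (P : ∀ (X : Type u) [NormedAddCommGroup X] [NormedSpace ℝ X], Prop) : Prop :=
  ∀ (X : Type u) [NormedAddCommGroup X] [NormedSpace ℝ X] [CompleteSpace X]
    [TopologicalSpace.SeparableSpace X] (Y : Submodule ℝ X) [IsClosed (Y : Set X)],
    P Y → P (X ⧸ Y) → P X

end SzlenkIndex

end

namespace SzlenkIndex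
open Order Filter Topology

/-- `D` is a derivation on the sets satisfying `p`: it shrinks them, and `p` is inherited by
derived sets and by intersections of nonempty families. -/
structure IsDerivationOn {α : Type*} (D : Set α → Set α) (p : Set α → Prop) : Prop where
  deriv : ∀ S, p S → p (D S)
  subset : ∀ S, p S → D S ⊆ S
  sInter : ∀ F : Set (Set α), F.Nonempty → (∀ S ∈ F, p S) → p (⋂₀ F)

section Iter

variable {α : Type*} {D : Set α → Set α} {p : Set α → Prop} {L : Set α}

theorem mem_iter_limit {ξ : Ordinal.{0}} (h : IsSuccLimit ξ) {x : α} :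
    x ∈ iter D L ξ ↔ ∀ ζ < ξ, x ∈ iter D L ζ := by
  simp [iter_limit D L ξ h]

theorem IsDerivationOn.iter (hD : IsDerivationOn D p) (hL : p L) (ξ : Ordinal.{0}) :
    p (iter D L ξ) := by
  induction ξ using Ordinal.limitRecOn with
  | zero => rwa [iter_zero]
  | add_one ξ ih => rw [iter_add_one]; exact hD.deriv _ ih
  | limit ξ h ih =>
    have : SzlenkIndex.iter D L ξ = ⋂₀ ((fun ζ => SzlenkIndex.iter D L ζ) '' Set.Iio ξ) := by
      ext x; simp [mem_iter_limit h]
    rw [this]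
    refine hD.sInter _ ⟨_, 0, h.bot_lt, rfl⟩ ?_
    rintro _ ⟨ζ, hζ, rfl⟩
    exact ih ζ hζ

theorem IsDerivationOn.iter_subset (hD : IsDerivationOn D p) (hL : p L) {ζ ξ : Ordinal.{0}}
    (h : ζ ≤ ξ) : SzlenkIndex.iter D L ξ ⊆ SzlenkIndex.iter D L ζ := by
  induction ξ using Ordinal.limitRecOn with
  | zero => rw [nonpos_iff_eq_zero.1 h]
  | add_one ξ ih =>
    rcases h.eq_or_lt with rfl | h
    · rfl
    · rw [iter_add_one]
      exact (hD.subset _ (hD.iter hL ξ)).trans (ih (Order.lt_add_one_iff.1 h))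
  | limit ξ hξ ih =>
    rcases h.eq_or_lt with rfl | h
    · rfl
    · exact fun x hx => (mem_iter_limit hξ).1 hx _ h

theorem IsDerivationOn.iter_add (hD : IsDerivationOn D p) (hL : p L) (ζ ξ : Ordinal.{0}) :
    SzlenkIndex.iter D L (ζ + ξ) = SzlenkIndex.iter D (SzlenkIndex.iter D L ζ) ξ := by
  induction ξ using Ordinal.limitRecOn with
  | zero => rw [add_zero, iter_zero]
  | add_one ξ ih => rw [← add_assoc, iter_add_one, iter_add_one, ih]
  | limit ξ h ih =>
    ext x
    rw [mem_iter_limit h, mem_iter_limit (Ordinal.isSuccLimit_add ζ h)]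
    refine ⟨fun H η hη => ih η hη ▸ H _ (by gcongr), fun H η hη => ?_⟩
    rcases le_total η ζ with h' | h'
    · refine hD.iter_subset hL h' ?_
      simpa [iter_zero] using H 0 h.bot_lt
    · obtain ⟨θ, rfl⟩ := exists_add_of_le h'
      have hθ : θ < ξ := by simpa using hη
      rw [ih θ hθ]
      exact H θ hθ

theorem index_le_omega_one : index D L ≤ ω₁ :=
  csInf_le' (Set.mem_insert _ _)

theorem index_le {ξ : Ordinal.{0}} (hξ : ξ < ω₁) (h : iter D L ξ = ∅) : index D L ≤ ξ :=
  csInf_le' (Or.inr ⟨hξ, h⟩)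

theorem iter_index (h : index D L < ω₁) : iter D L (index D L) = ∅ := by
  have := csInf_mem (s := insert ω₁ {ξ : Ordinal.{0} | ξ < ω₁ ∧ iter D L ξ = ∅})
    (Set.insert_nonempty _ _)
  rcases this with h' | h'
  · exact absurd h' h.ne
  · exact h'.2

theorem index_pos (h : L.Nonempty) : 0 < index D L := by
  rw [pos_iff_ne_zero]
  intro h0
  have h1 : index D L < ω₁ := h0 ▸ Ordinal.omega_pos 1
  have := iter_index h1
  rw [h0, iter_zero] at this
  exact h.ne_empty this

end Iter

theorem lt_omega_one_iff {ξ : Ordinal.{0}} : ξ < ω₁ ↔ ξ.card ≤ Cardinal.aleph0 := by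
  rw [Cardinal.card_le_iff, Cardinal.succ_aleph0, Cardinal.ord_aleph]

theorem mul_lt_omega_one {ζ ξ : Ordinal.{0}} (hζ : ζ < ω₁) (hξ : ξ < ω₁) : ζ * ξ < ω₁ := by
  rw [lt_omega_one_iff] at *
  rw [Ordinal.card_mul]
  exact (mul_le_mul' hζ hξ).trans Cardinal.aleph0_mul_aleph0.le

theorem omega0_opow_lt_omega_one {ξ : Ordinal.{0}} (hξ : ξ < ω₁) : ω ^ ξ < ω₁ := by
  rw [lt_omega_one_iff] at *
  refine (Ordinal.card_opow_le_of_omega0_le_left le_rfl ξ).trans ?_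
  simpa using hξ

section WeakStar

variable {X : Type*} [NormedAddCommGroup X] [NormedSpace ℝ X]
  {Z : Type*} [NormedAddCommGroup Z] [NormedSpace ℝ Z]

/-- Weak-star compactness of a set of functionals. -/
def IsWeakStarCompact (L : Set (StrongDual ℝ X)) : Prop :=
  IsCompact (StrongDual.toWeakDual.symm ⁻¹' L : Set (WeakDual ℝ X))

theorem isWeakStarCompact_closedBall (f : StrongDual ℝ X) (r : ℝ) :
    IsWeakStarCompact (Metric.closedBall f r) :=
  WeakDual.isCompact_closedBall f r

theorem isClosed_szlenkDerivative (ε : ℝ) (L : Set (StrongDual ℝ X)) :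
    IsClosed (StrongDual.toWeakDual.symm ⁻¹' szlenkDerivative ε L : Set (WeakDual ℝ X)) := by
  rw [← isOpen_compl_iff, isOpen_iff_mem_nhds]
  intro f hf
  simp only [Set.mem_compl_iff, Set.mem_preimage, szlenkDerivative, Set.mem_ofPred_eq,
    LinearEquiv.apply_symm_apply, not_forall] at hf
  obtain ⟨V, hV, h⟩ := hf
  obtain ⟨U, hUV, hU, hfU⟩ := mem_nhds_iff.1 hV
  filter_upwards [hU.mem_nhds hfU] with g hg hg'
  exact h ((hg' V (mem_of_superset (hU.mem_nhds (by simpa using hg)) hUV)))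

theorem szlenkDerivative_subset {ε : ℝ} {L : Set (StrongDual ℝ X)} (hL : IsWeakStarCompact L) :
    szlenkDerivative ε L ⊆ L := by
  intro f hf
  by_contra hfL
  have := hf _ (hL.isClosed.isOpen_compl.mem_nhds (x := StrongDual.toWeakDual f) (by simpa))
  have he : StrongDual.toWeakDual ⁻¹' (StrongDual.toWeakDual.symm ⁻¹' L)ᶜ ∩ L = ∅ := by
    ext g; simp
  rw [he] at this
  simp at this

theorem isDerivationOn_szlenkDerivative (ε : ℝ) :
    IsDerivationOn (szlenkDerivative (X := X) ε) IsWeakStarCompact where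
  subset _ hS := szlenkDerivative_subset hS
  deriv S hS := hS.of_isClosed_subset (isClosed_szlenkDerivative ε S)
    (Set.preimage_mono (szlenkDerivative_subset hS))
  sInter F hF h := by
    obtain ⟨S, hS⟩ := hF
    refine (h S hS).of_isClosed_subset ?_ (Set.preimage_mono (Set.sInter_subset_of_mem hS))
    rw [Set.sInter_eq_biInter, Set.preimage_iInter₂]
    exact isClosed_biInter fun T hT => (h T hT).isClosed

theorem exists_mem_szlenkDerivative_norm_sub_le {T : StrongDual ℝ Z → StrongDual ℝ X}
    (hT : Continuous fun c : WeakDual ℝ Z =>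
      StrongDual.toWeakDual (T (StrongDual.toWeakDual.symm c)))
    {k : ℝ} (hk : 0 ≤ k) (hTk : ∀ c c', ‖T c - T c'‖ ≤ k * ‖c - c'‖)
    {ε η δ : ℝ} (hη : 0 ≤ η) (h : 2 * (k * η + 2 * δ) ≤ ε)
    {L : Set (StrongDual ℝ X)} {C : Set (StrongDual ℝ Z)} (hC : IsWeakStarCompact C)
    {V : Set (WeakDual ℝ X)} (hV : IsOpen V)
    (hLC : ∀ p ∈ L, StrongDual.toWeakDual p ∈ V → ∃ c ∈ C, ‖p - T c‖ ≤ δ)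
    {p : StrongDual ℝ X} (hp : p ∈ szlenkDerivative ε L) (hpV : StrongDual.toWeakDual p ∈ V) :
    ∃ c ∈ szlenkDerivative η C, ‖p - T c‖ ≤ δ := by
  set A : Set (WeakDual ℝ X) := {q | StrongDual.toWeakDual.symm q ∈ L ∧ q ∈ V ∧
    ε / 2 < ‖StrongDual.toWeakDual.symm q - p‖}
  have hne : (𝓝 (StrongDual.toWeakDual p) ⊓ 𝓟 A).NeBot := by
    refine mem_closure_iff_clusterPt.1 (mem_closure_iff_nhds.2 ?_)
    intro U hU
    by_contra hUA
    refine absurd (hp _ (inter_mem hU (hV.mem_nhds hpV))) (not_lt.2 ?_)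
    have key : ∀ q : StrongDual ℝ X, StrongDual.toWeakDual q ∈ U ∩ V → q ∈ L →
        ‖q - p‖ ≤ ε / 2 := fun q hq hqL => by
      by_contra hcon
      exact hUA ⟨_, hq.1, by simpa using hqL, hq.2, by simpa using hcon⟩
    refine Metric.ediam_le fun a ha b hb => ?_
    rw [edist_dist]
    refine ENNReal.ofReal_le_ofReal ?_
    have h1 := key a ha.1 ha.2
    have h2 := key b hb.1 hb.2
    calc dist a b ≤ dist a p + dist b p := dist_triangle_right ..
      _ ≤ ε / 2 + ε / 2 := by rw [dist_eq_norm, dist_eq_norm]; gcongr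
      _ = ε := by ring
  obtain ⟨𝒰, h𝒰⟩ := exists_ultrafilter_le (𝓝 (StrongDual.toWeakDual p) ⊓ 𝓟 A)
  have h𝒰p : Tendsto id (𝒰 : Filter (WeakDual ℝ X)) (𝓝 (StrongDual.toWeakDual p)) :=
    h𝒰.trans inf_le_left
  have h𝒰A : ∀ᶠ q in (𝒰 : Filter (WeakDual ℝ X)), q ∈ A := by
    have := h𝒰.trans inf_le_right
    simpa using this
  have hex : ∀ q : WeakDual ℝ X, ∃ c : StrongDual ℝ Z, q ∈ A →
      c ∈ C ∧ ‖StrongDual.toWeakDual.symm q - T c‖ ≤ δ := fun q => by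
    by_cases hq : q ∈ A
    · obtain ⟨c, hc⟩ := hLC _ hq.1 (by simpa using hq.2.1)
      exact ⟨c, fun _ => hc⟩
    · exact ⟨0, fun h => absurd h hq⟩
  choose c hc using hex
  obtain ⟨c₀, hc₀C, hc₀⟩ := hC.ultrafilter_le_nhds (𝒰.map fun q => StrongDual.toWeakDual (c q))
    (by
      rw [le_principal_iff, Ultrafilter.mem_coe, Ultrafilter.mem_map, ← Ultrafilter.mem_coe]
      filter_upwards [h𝒰A] with q hq
      simpa using (hc q hq).1)
  replace hc₀ : Tendsto (fun q => StrongDual.toWeakDual (c q)) (𝒰 : Filter (WeakDual ℝ X))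
    (𝓝 c₀) := hc₀
  obtain ⟨d, rfl⟩ := StrongDual.toWeakDual.surjective c₀
  have hlim : Tendsto (fun q => q - StrongDual.toWeakDual (T (c q)))
      (𝒰 : Filter (WeakDual ℝ X)) (𝓝 (StrongDual.toWeakDual p - StrongDual.toWeakDual (T d))) := by
    refine h𝒰p.sub ?_
    exact (hT.tendsto (StrongDual.toWeakDual d)).comp hc₀
  have hpd : ‖p - T d‖ ≤ δ := by
    have := (WeakDual.isClosed_closedBall (0 : StrongDual ℝ X) δ).mem_of_tendsto hlim
      (by
        filter_upwards [h𝒰A] with q hq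
        have := (hc q hq).2
        simpa using this)
    simpa using this
  refine ⟨d, ?_, hpd⟩
  intro W hW
  by_contra hcon
  have hdiam := not_lt.1 hcon
  obtain ⟨q, hqW, hqA⟩ := ((hc₀.eventually hW).and h𝒰A).exists
  have h1 : ‖c q - d‖ ≤ η := by
    have hmem : c q ∈ StrongDual.toWeakDual ⁻¹' W ∩ C := ⟨hqW, (hc q hqA).1⟩
    have hmem' : d ∈ StrongDual.toWeakDual ⁻¹' W ∩ C :=
      ⟨mem_of_mem_nhds (x := StrongDual.toWeakDual d) hW, by simpa using hc₀C⟩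
    have := (Metric.edist_le_ediam_of_mem hmem hmem').trans hdiam
    rwa [edist_dist, ENNReal.ofReal_le_ofReal_iff hη, dist_eq_norm] at this
  have h2 := (hc q hqA).2
  have h3 := hqA.2.2
  have h4 := hTk (c q) d
  set q' := StrongDual.toWeakDual.symm q
  have h5 : ‖q' - p‖ ≤ δ + k * η + δ := by
    calc ‖q' - p‖ = ‖(q' - T (c q)) + (T (c q) - T d) + -(p - T d)‖ := by congr 1; abel
      _ ≤ ‖q' - T (c q)‖ + ‖T (c q) - T d‖ + ‖-(p - T d)‖ := norm_add₃_le
      _ ≤ δ + k * η + δ := by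
        rw [norm_neg]
        gcongr
        exact h4.trans (by gcongr)
  linarith

theorem exists_mem_iter_szlenkDerivative_norm_sub_le {T : StrongDual ℝ Z → StrongDual ℝ X}
    (hT : Continuous fun c : WeakDual ℝ Z =>
      StrongDual.toWeakDual (T (StrongDual.toWeakDual.symm c)))
    {k : ℝ} (hk : 0 ≤ k) (hTk : ∀ c c', ‖T c - T c'‖ ≤ k * ‖c - c'‖)
    {ε η δ : ℝ} (hη : 0 ≤ η) (h : 2 * (k * η + 2 * δ) ≤ ε)
    {L : Set (StrongDual ℝ X)} {C : Set (StrongDual ℝ Z)} (hC : IsWeakStarCompact C)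
    {V : Set (WeakDual ℝ X)} (hV : IsOpen V)
    (hLC : ∀ p ∈ L, StrongDual.toWeakDual p ∈ V → ∃ c ∈ C, ‖p - T c‖ ≤ δ)
    (ξ : Ordinal.{0}) :
    ∀ p ∈ iter (szlenkDerivative ε) L ξ, StrongDual.toWeakDual p ∈ V →
      ∃ c ∈ iter (szlenkDerivative η) C ξ, ‖p - T c‖ ≤ δ := by
  have hD := isDerivationOn_szlenkDerivative (X := Z) η
  induction ξ using Ordinal.limitRecOn with
  | zero => simpa only [iter_zero] using hLC
  | add_one ξ ih =>
    intro p hp hpV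
    rw [iter_add_one] at hp ⊢
    exact exists_mem_szlenkDerivative_norm_sub_le hT hk hTk hη h (hD.iter hC ξ) hV ih hp hpV
  | limit ξ hξ ih =>
    intro p hp hpV
    rw [mem_iter_limit hξ] at hp
    have hcl : IsClosed {c : WeakDual ℝ Z | ‖p - T (StrongDual.toWeakDual.symm c)‖ ≤ δ} := by
      have hcont : Continuous fun c : WeakDual ℝ Z => StrongDual.toWeakDual p -
        StrongDual.toWeakDual (T (StrongDual.toWeakDual.symm c)) := continuous_const.sub hT
      convert (WeakDual.isClosed_closedBall (0 : StrongDual ℝ X) δ).preimage hcont using 1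
      ext c; simp [← map_sub]
    let A : Set.Iio ξ → Set (WeakDual ℝ Z) := fun ζ =>
      StrongDual.toWeakDual.symm ⁻¹' iter (szlenkDerivative η) C ζ ∩
        {c | ‖p - T (StrongDual.toWeakDual.symm c)‖ ≤ δ}
    have hAc : ∀ ζ, IsCompact (A ζ) := fun ζ => (hD.iter hC ζ).inter_right hcl
    have : Nonempty (Set.Iio ξ) := ⟨⟨0, hξ.bot_lt⟩⟩
    have hanti : Antitone A := fun ζ ζ' hle => Set.inter_subset_inter_left _
      (Set.preimage_mono (hD.iter_subset hC hle))
    obtain ⟨c, hc⟩ := IsCompact.nonempty_iInter_of_directed_nonempty_isCompact_isClosed A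
      hanti.directed_ge (fun ζ => by
        obtain ⟨c, hc, hpc⟩ := ih ζ ζ.2 p (hp ζ ζ.2) hpV
        exact ⟨StrongDual.toWeakDual c, by simpa using hc, by simpa using hpc⟩)
      hAc (fun ζ => (hAc ζ).isClosed)
    rw [Set.mem_iInter] at hc
    refine ⟨StrongDual.toWeakDual.symm c, (mem_iter_limit hξ).2 fun ζ hζ => (hc ⟨ζ, hζ⟩).1, ?_⟩
    exact (hc ⟨0, hξ.bot_lt⟩).2

end WeakStar

/-- `π` presents the normed space `Z` as the quotient of `X` by `Y`. -/
structure IsMetricQuotient {X : Type*} [NormedAddCommGroup X] [NormedSpace ℝ X]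
    {Z : Type*} [NormedAddCommGroup Z] [NormedSpace ℝ Z] (Y : Submodule ℝ X) (π : X →L[ℝ] Z) :
    Prop where
  norm_le : ∀ x, ‖π x‖ ≤ ‖x‖
  exists_norm_lt : ∀ z, ∀ η : ℝ, 0 < η → ∃ x, π x = z ∧ ‖x‖ < ‖z‖ + η
  eq_zero_iff : ∀ x, π x = 0 ↔ x ∈ Y

/-- The quotient map, continuous for the topology of the quotient norm. -/
noncomputable def quotientMap {X : Type*} [NormedAddCommGroup X] [NormedSpace ℝ X] (Y : Submodule ℝ X)
    [IsClosed (Y : Set X)] : X →L[ℝ] (X ⧸ Y) :=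
  LinearMap.mkContinuous Y.mkQ 1 fun x => by
    rw [one_mul]; exact Submodule.Quotient.norm_mk_le Y x

theorem isMetricQuotient_quotientMap {X : Type*} [NormedAddCommGroup X] [NormedSpace ℝ X]
    (Y : Submodule ℝ X) [IsClosed (Y : Set X)] : IsMetricQuotient Y (quotientMap Y) where
  norm_le x := Submodule.Quotient.norm_mk_le Y x
  exists_norm_lt z _ hη := Submodule.Quotient.norm_mk_lt z hη
  eq_zero_iff _ := Submodule.Quotient.mk_eq_zero Y

section ThreeSpace

variable {X : Type*} [NormedAddCommGroup X] [NormedSpace ℝ X] {Y : Submodule ℝ X}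
  {Z : Type*} [NormedAddCommGroup Z] [NormedSpace ℝ Z] {π : X →L[ℝ] Z}

theorem IsMetricQuotient.exists_factor (hπ : IsMetricQuotient Y π) {g : StrongDual ℝ X}
    (hg : ∀ y ∈ Y, g y = 0) {r : ℝ} (hr : 0 < r) (hgr : ‖g‖ ≤ r) :
    ∃ c : StrongDual ℝ Z, ‖c‖ ≤ r ∧ ∀ x, c (π x) = g x := by
  have hsurj : Function.Surjective π := fun z => by
    obtain ⟨x, hx, -⟩ := hπ.exists_norm_lt z 1 one_pos
    exact ⟨x, hx⟩
  have hfac : ∀ x x', π x = π x' → g x = g x' := fun x x' h => by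
    rw [← sub_eq_zero, ← map_sub]
    exact hg _ ((hπ.eq_zero_iff _).1 (by rw [map_sub, h, sub_self]))
  choose s hs using hsurj
  have hgs : ∀ x, g (s (π x)) = g x := fun x => hfac _ _ (hs _)
  let c₀ : Z →ₗ[ℝ] ℝ :=
    { toFun := fun z => g (s z)
      map_add' := fun z w => by
        rw [← map_add]
        exact hfac _ _ (by rw [hs, map_add, hs, hs])
      map_smul' := fun t z => by
        rw [RingHom.id_apply, ← map_smul]
        exact hfac _ _ (by rw [hs, map_smul, hs]) }
  have hbound : ∀ z, ‖c₀ z‖ ≤ r * ‖z‖ := by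
    intro z
    refine le_of_forall_pos_le_add fun η hη => ?_
    obtain ⟨x, rfl, hx⟩ := hπ.exists_norm_lt z (η / r) (by positivity)
    calc ‖c₀ (π x)‖ = ‖g x‖ := by rw [← hgs x]; rfl
      _ ≤ r * ‖x‖ := g.le_of_opNorm_le hgr x
      _ ≤ r * (‖π x‖ + η / r) := by gcongr
      _ = r * ‖π x‖ + η := by field_simp
  exact ⟨c₀.mkContinuous r hbound, c₀.mkContinuous_norm_le hr.le hbound, hgs⟩

/-- Functionals whose restrictions to `Y` are close differ, up to a small perturbation, by a
functional on the quotient. -/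
theorem IsMetricQuotient.exists_norm_sub_le (hπ : IsMetricQuotient Y π) {δ : ℝ} (hδ : δ ≤ 1)
    {p q : StrongDual ℝ X} (hp : ‖p‖ ≤ 1) (hq : ‖q‖ ≤ 1)
    (h : ‖(p - q).comp Y.subtypeL‖ ≤ δ) :
    ∃ c : StrongDual ℝ Z, ‖c‖ ≤ 1 ∧ ‖p - (q + (3 : ℝ) • c.comp π)‖ ≤ δ := by
  obtain ⟨e, he, hen⟩ := exists_extension_norm_eq Y ((p - q).comp Y.subtypeL)
  have hker : ∀ y ∈ Y, (p - q - e) y = 0 := fun y hy => by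
    have := he ⟨y, hy⟩
    simp at this
    simp [this]
  have hen' : ‖e‖ ≤ δ := hen ▸ h
  have hnorm : ‖p - q - e‖ ≤ 3 := by
    calc ‖p - q - e‖ ≤ ‖p‖ + ‖q‖ + ‖e‖ := (norm_sub_le _ _).trans (by gcongr; exact norm_sub_le _ _)
      _ ≤ 3 := by linarith
  obtain ⟨c, hc, hcπ⟩ := hπ.exists_factor hker (by norm_num) hnorm
  refine ⟨(3 : ℝ)⁻¹ • c, ?_, ?_⟩
  · rw [norm_smul]
    norm_num
    linarith
  · convert hen' using 2
    ext x
    have := hcπ x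
    simp at this
    simp [this]
    ring

theorem IsMetricQuotient.comp_mem_iter_szlenkDerivative (hπ : IsMetricQuotient Y π)
    {ε η : ℝ} (hη : 0 ≤ η) (hη1 : η ≤ 1) (h : 10 * η ≤ ε) {ζ : Ordinal.{0}}
    (hζ : iter (szlenkDerivative η) (Metric.closedBall (0 : StrongDual ℝ Z) 1) ζ = ∅)
    (ξ : Ordinal.{0}) :
    ∀ p ∈ iter (szlenkDerivative ε) (Metric.closedBall (0 : StrongDual ℝ X) 1) (ζ * ξ),
      p.comp Y.subtypeL ∈
        iter (szlenkDerivative (X := Y) η) (Metric.closedBall 0 1) ξ := by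
  have hD := isDerivationOn_szlenkDerivative (X := X) ε
  have hB := isWeakStarCompact_closedBall (0 : StrongDual ℝ X) 1
  have hζ0 : 0 < ζ := by
    rw [pos_iff_ne_zero]
    rintro rfl
    rw [iter_zero] at hζ
    exact (Metric.nonempty_closedBall.2 zero_le_one).ne_empty hζ
  induction ξ using Ordinal.limitRecOn with
  | zero =>
    simp only [mul_zero, iter_zero]
    intro p hp
    rw [mem_closedBall_zero_iff] at hp
    refine mem_closedBall_zero_iff.2 ?_
    refine ContinuousLinearMap.opNorm_le_bound _ zero_le_one fun y => ?_
    exact p.le_of_opNorm_le hp (y : X)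
  | add_one ξ ih =>
    intro q hq
    rw [mul_add_one, hD.iter_add hB] at hq
    rw [iter_add_one]
    set K := iter (szlenkDerivative ε) (Metric.closedBall (0 : StrongDual ℝ X) 1) (ζ * ξ)
    set M := iter (szlenkDerivative (X := Y) η) (Metric.closedBall 0 1) ξ
    have hK : IsWeakStarCompact K := hD.iter hB _
    have hK1 : ∀ p ∈ K, ‖p‖ ≤ 1 := fun p hp => by
      have := hD.iter_subset hB (zero_le : 0 ≤ ζ * ξ) hp
      rwa [iter_zero, mem_closedBall_zero_iff] at this
    have hqK : q ∈ K := by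
      have := hD.iter_subset hK (zero_le : 0 ≤ ζ) hq
      rwa [iter_zero] at this
    intro U hU
    by_contra hcon
    have hdiam := not_lt.1 hcon
    obtain ⟨U', hUU', hU', hqU'⟩ := mem_nhds_iff.1 hU
    have hres : Continuous fun p : WeakDual ℝ X => (StrongDual.toWeakDual
        ((StrongDual.toWeakDual.symm p).comp Y.subtypeL) : WeakDual ℝ Y) :=
      WeakDual.continuous_of_continuous_eval fun y => WeakDual.eval_continuous (y : X)
    have hT : Continuous fun c : WeakDual ℝ Z => StrongDual.toWeakDual
        (q + (3 : ℝ) • (StrongDual.toWeakDual.symm c).comp π) :=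
      WeakDual.continuous_of_continuous_eval fun x =>
        (continuous_const (y := q x)).add ((WeakDual.eval_continuous (π x)).const_smul (3 : ℝ))
    have hTk : ∀ c c' : StrongDual ℝ Z, ‖(q + (3 : ℝ) • c.comp π) -
        (q + (3 : ℝ) • c'.comp π)‖ ≤ 3 * ‖c - c'‖ := fun c c' => by
      refine ContinuousLinearMap.opNorm_le_bound _ (by positivity) fun x => ?_
      have : ((q + (3 : ℝ) • c.comp π) - (q + (3 : ℝ) • c'.comp π)) x = 3 * (c - c') (π x) := by
        simp; ring
      rw [this, norm_mul, Real.norm_of_nonneg zero_le_three, mul_assoc]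
      gcongr
      refine ((c - c').le_opNorm _).trans ?_
      gcongr
      exact hπ.norm_le x
    have hmem : q.comp Y.subtypeL ∈ StrongDual.toWeakDual ⁻¹' U ∩ M := ⟨hUU' hqU', ih q hqK⟩
    have := exists_mem_iter_szlenkDerivative_norm_sub_le (δ := η) hT (by norm_num) hTk hη
      (by linarith) (isWeakStarCompact_closedBall 0 1) (hU'.preimage hres)
      (fun p hp hpU => by
        have hmem' : p.comp Y.subtypeL ∈ StrongDual.toWeakDual ⁻¹' U ∩ M := ⟨hUU' hpU, ih p hp⟩
        have : ‖(p - q).comp Y.subtypeL‖ ≤ η := by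
          have := (Metric.edist_le_ediam_of_mem hmem' hmem).trans hdiam
          rwa [edist_dist, ENNReal.ofReal_le_ofReal_iff hη, dist_eq_norm] at this
        simpa using hπ.exists_norm_sub_le hη1 (hK1 p hp) (hK1 q hqK) this)
      ζ q hq hqU'
    simp [hζ] at this
  | limit ξ hξ ih =>
    intro p hp
    rw [mem_iter_limit (Ordinal.isSuccLimit_mul_right hζ0 hξ)] at hp
    exact (mem_iter_limit hξ).2 fun θ hθ => ih θ hθ p (hp _ (by gcongr))

theorem szlenkIndexAt_le_mul (Y : Submodule ℝ X) [IsClosed (Y : Set X)]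
    {ε η : ℝ} (hη : 0 ≤ η) (hη1 : η ≤ 1) (h : 10 * η ≤ ε)
    (hY : szlenkIndexAt (X := Y) η (Metric.closedBall 0 1) < ω₁)
    (hZ : szlenkIndexAt (X := X ⧸ Y) η (Metric.closedBall 0 1) < ω₁) :
    szlenkIndexAt ε (Metric.closedBall (0 : StrongDual ℝ X) 1) ≤
      szlenkIndexAt (X := X ⧸ Y) η (Metric.closedBall 0 1) *
        szlenkIndexAt (X := Y) η (Metric.closedBall 0 1) := by
  refine index_le (mul_lt_omega_one hZ hY) (Set.eq_empty_of_forall_notMem fun p hp => ?_)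
  have := (isMetricQuotient_quotientMap Y).comp_mem_iter_szlenkDerivative hη hη1 h
    (iter_index hZ) _ p hp
  rw [szlenkIndexAt, iter_index hY] at this
  exact this

end ThreeSpace

section SzlenkIndexOfSpace

variable {X : Type*} [NormedAddCommGroup X] [NormedSpace ℝ X]

theorem szlenkIndexAt_le_Sz {ε : ℝ} (hε : 0 < ε) :
    szlenkIndexAt ε (Metric.closedBall (0 : StrongDual ℝ X) 1) ≤ Sz X :=
  Ordinal.le_iSup (fun ε : Set.Ioi (0 : ℝ) =>
    szlenkIndexAt (ε : ℝ) (Metric.closedBall (0 : StrongDual ℝ X) 1)) ⟨ε, hε⟩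

theorem not_isSuccLimit_szlenkIndexAt {ε : ℝ}
    (h : szlenkIndexAt ε (Metric.closedBall (0 : StrongDual ℝ X) 1) < ω₁) :
    ¬ IsSuccLimit (szlenkIndexAt ε (Metric.closedBall (0 : StrongDual ℝ X) 1)) := by
  intro hlim
  have hD := isDerivationOn_szlenkDerivative (X := X) ε
  have hB := isWeakStarCompact_closedBall (0 : StrongDual ℝ X) 1
  set ξ := szlenkIndexAt ε (Metric.closedBall (0 : StrongDual ℝ X) 1) with hξ
  let A : Set.Iio ξ → Set (WeakDual ℝ X) := fun ζ =>
    StrongDual.toWeakDual.symm ⁻¹' iter (szlenkDerivative ε) (Metric.closedBall 0 1) ζ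
  have hAc : ∀ ζ, IsCompact (A ζ) := fun ζ => hD.iter hB ζ
  have : Nonempty (Set.Iio ξ) := ⟨⟨0, hlim.bot_lt⟩⟩
  have hanti : Antitone A := fun ζ ζ' hle => Set.preimage_mono (hD.iter_subset hB hle)
  obtain ⟨p, hp⟩ := IsCompact.nonempty_iInter_of_directed_nonempty_isCompact_isClosed A
    hanti.directed_ge (fun ζ => by
      rw [Set.nonempty_iff_ne_empty]
      intro hemp
      refine (lt_irrefl ξ) ((index_le (ζ.2.trans h) ?_).trans_lt ζ.2)
      simpa using Set.preimage_eq_empty_iff.1 hemp)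
    hAc (fun ζ => (hAc ζ).isClosed)
  rw [Set.mem_iInter] at hp
  have hmem : StrongDual.toWeakDual.symm p ∈
      iter (szlenkDerivative ε) (Metric.closedBall (0 : StrongDual ℝ X) 1) ξ :=
    (mem_iter_limit hlim).2 fun ζ hζ => hp ⟨ζ, hζ⟩
  have hemp : iter (szlenkDerivative ε) (Metric.closedBall (0 : StrongDual ℝ X) 1) ξ = ∅ :=
    iter_index h
  rwa [hemp] at hmem

theorem szlenkIndexAt_lt_of_Sz_le {ξ : Ordinal.{0}} (hξ : IsSuccLimit ξ) (hξ1 : ξ < ω₁)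
    (h : Sz X ≤ ξ) {ε : ℝ} (hε : 0 < ε) :
    szlenkIndexAt ε (Metric.closedBall (0 : StrongDual ℝ X) 1) < ξ := by
  have hle := (szlenkIndexAt_le_Sz hε).trans h
  refine hle.lt_of_ne fun heq => not_isSuccLimit_szlenkIndexAt (hle.trans_lt hξ1) ?_
  rwa [heq]

theorem Sz_le_of_forall {ξ : Ordinal.{0}}
    (h : ∀ ε : ℝ, 0 < ε → szlenkIndexAt ε (Metric.closedBall (0 : StrongDual ℝ X) 1) ≤ ξ) :
    Sz X ≤ ξ :=
  ciSup_le' fun ε => h ε ε.2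

end SzlenkIndexOfSpace

theorem isThreeSpaceProperty_Sz_le {ξ : Ordinal.{0}} (hξ : ξ < ω₁) :
    IsThreeSpaceProperty.{u} (fun X _ _ => Sz X ≤ ω ^ ω ^ ξ) := by
  intro X _ _ _ _ Y _ hY hZ
  have h1 : ω ^ ω ^ ξ < ω₁ := omega0_opow_lt_omega_one (omega0_opow_lt_omega_one hξ)
  have hlim : IsSuccLimit (ω ^ ω ^ ξ) := Ordinal.isSuccLimit_opow_left Ordinal.isSuccLimit_omega0
    (Ordinal.opow_pos _ Ordinal.omega0_pos).ne'
  refine Sz_le_of_forall fun ε hε => ?_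
  have hη : 0 < min 1 (ε / 10) := by positivity
  have hY' := szlenkIndexAt_lt_of_Sz_le hlim h1 hY hη
  have hZ' := szlenkIndexAt_lt_of_Sz_le hlim h1 hZ hη
  refine (szlenkIndexAt_le_mul Y hη.le (min_le_left _ _) ?_ (hY'.trans h1) (hZ'.trans h1)).trans
    (Ordinal.isPrincipal_mul_omega0_opow_opow ξ hZ' hY').le
  have := min_le_right 1 (ε / 10)
  linarith

theorem isThreeSpaceProperty_Sz_lt {ξ : Ordinal.{0}} (hξ : ξ < ω₁) :
    IsThreeSpaceProperty.{u} (fun X _ _ => Sz X < ω ^ ω ^ ξ) := by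
  intro X _ _ _ _ Y _ hY hZ
  have h1 : ω ^ ω ^ ξ < ω₁ := omega0_opow_lt_omega_one (omega0_opow_lt_omega_one hξ)
  refine lt_of_le_of_lt (Sz_le_of_forall fun ε hε => ?_)
    (Ordinal.isPrincipal_mul_omega0_opow_opow ξ hZ hY)
  have hη : 0 < min 1 (ε / 10) := by positivity
  have hY' := szlenkIndexAt_le_Sz (X := Y) hη
  have hZ' := szlenkIndexAt_le_Sz (X := X ⧸ Y) hη
  refine (szlenkIndexAt_le_mul Y hη.le (min_le_left _ _) ?_ (hY'.trans_lt (hY.trans h1))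
    (hZ'.trans_lt (hZ.trans h1))).trans (mul_le_mul' hZ' hY')
  have := min_le_right 1 (ε / 10)
  linarith

theorem isDerivationOn_sigmaDerivative {S : Type*} (σ : Set (ℕ → S)) :
    IsDerivationOn (sigmaDerivative σ) fun _ => True where
  deriv _ _ := trivial
  subset _ _ _ h := h.1
  sInter _ _ _ := trivial

theorem exists_mem_convexHull_norm_lt {E : Type*} [NormedAddCommGroup E] [NormedSpace ℝ E]
    {S : Set E} {δ : ℝ} (hδ : 0 < δ)
    (h : ¬ ∃ f : StrongDual ℝ E, ‖f‖ ≤ 1 ∧ ∀ x ∈ S, δ ≤ f x) :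
    ∃ z ∈ convexHull ℝ S, ‖z‖ < δ := by
  by_contra! hcon
  refine h ?_
  obtain ⟨f, c, hfc, hcf⟩ := geometric_hahn_banach_open (convex_ball (0 : E) δ) Metric.isOpen_ball
    (convex_convexHull ℝ S) (Set.disjoint_left.2 fun z hz hzS =>
      (hcon z hzS).not_gt (mem_ball_zero_iff.1 hz))
  have hc : 0 < c := by simpa using hfc 0 (Metric.mem_ball_self hδ)
  have hf : ‖f‖ ≤ c / δ := by
    have hball : Metric.ball 0 δ ⊆ {z | ‖f z‖ ≤ c} := fun z hz => by
      have hz' : -z ∈ Metric.ball (0 : E) δ := by simpa using hz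
      have := hfc _ hz'
      rw [map_neg] at this
      exact abs_le.2 ⟨by linarith, (hfc z hz).le⟩
    have := closure_minimal hball (isClosed_le f.continuous.norm continuous_const)
    rw [closure_ball _ hδ.ne'] at this
    exact f.opNorm_bound_of_ball_bound hδ c this
  refine ⟨(δ / c) • f, ?_, fun x hx => ?_⟩
  · rw [norm_smul, Real.norm_of_nonneg (by positivity)]
    calc δ / c * ‖f‖ ≤ δ / c * (c / δ) := by gcongr
      _ = 1 := by field_simp
  · have := hcf x (subset_convexHull ℝ S hx)
    calc δ = δ / c * c := by field_simp
      _ ≤ δ / c * f x := by gcongr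

theorem tendsto_dual_zero_of_denseRange {E : Type*} [NormedAddCommGroup E] [NormedSpace ℝ E]
    {f : ℕ → StrongDual ℝ E} (hf : DenseRange f) {R : ℝ} {z : ℕ → E} (hz : ∀ n, ‖z n‖ ≤ R)
    (h : ∀ j, Tendsto (fun n => f j (z n)) atTop (𝓝 0)) (g : StrongDual ℝ E) :
    Tendsto (fun n => g (z n)) atTop (𝓝 0) := by
  have hR : 0 ≤ R := (norm_nonneg _).trans (hz 0)
  rw [Metric.tendsto_atTop]
  intro e he
  obtain ⟨j, hj⟩ := hf.exists_dist_lt g (show 0 < e / (2 * (R + 1)) by positivity)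
  obtain ⟨N, hN⟩ := Metric.tendsto_atTop.1 (h j) (e / 2) (half_pos he)
  refine ⟨N, fun n hn => ?_⟩
  have h1 := hN n hn
  rw [dist_zero_right] at h1 ⊢
  have h2 : ‖(g - f j) (z n)‖ ≤ e / 2 := by
    calc ‖(g - f j) (z n)‖ ≤ ‖g - f j‖ * ‖z n‖ := (g - f j).le_opNorm _
      _ ≤ e / (2 * (R + 1)) * (R + 1) := by
        rw [← dist_eq_norm]
        gcongr
        exact (hz n).trans (by linarith)
      _ = e / 2 := by field_simp
  calc ‖g (z n)‖ = ‖(g - f j) (z n) + f j (z n)‖ := by simp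
    _ ≤ ‖(g - f j) (z n)‖ + ‖f j (z n)‖ := norm_add_le _ _
    _ < e := by linarith

section ThreeSpaceWeaklyNull

variable {X : Type*} [NormedAddCommGroup X] [NormedSpace ℝ X] {Y : Submodule ℝ X}
  {Z : Type*} [NormedAddCommGroup Z] [NormedSpace ℝ Z] {π : X →L[ℝ] Z}

theorem nil_mem_H {ε : ℝ} : [] ∈ H X ε :=
  ⟨by simp, 0, by simp, by simp⟩

/-- If a sequence in `X` is weakly null and stays within `δ` of a sequence `y` in `Y`, then along a
subsequence `y` can be made weakly null by subtracting vectors of norm barely exceeding `δ`. -/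
theorem exists_subseq_sub_tendsto_zero {f : ℕ → StrongDual ℝ X} (hf : DenseRange f)
    {x : ℕ → X} {y : ℕ → Y} (hx : ∀ n, ‖x n‖ ≤ 1)
    (hfx : ∀ j, Tendsto (fun n => f j (x n)) atTop (𝓝 0)) {δ η : ℝ} (hη : 0 < η)
    (hxy : ∀ n, ‖x n - y n‖ ≤ δ) :
    ∃ (φ : ℕ → ℕ) (u : ℕ → Y), (∀ k, ‖u k‖ ≤ δ + η) ∧
      ∀ g : StrongDual ℝ Y, Tendsto (fun k => g (y (φ k) - u k)) atTop (𝓝 0) := by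
  have hy : ∀ n, ‖y n‖ ≤ 1 + δ := fun n => by
    calc ‖(y n : X)‖ = ‖x n - (x n - y n)‖ := by rw [sub_sub_cancel]
      _ ≤ 1 + δ := (norm_sub_le _ _).trans (add_le_add (hx n) (hxy n))
  have hcomp : IsCompact (Set.pi Set.univ fun j => Metric.closedBall (0 : ℝ) (‖f j‖ * (1 + δ))) :=
    isCompact_univ_pi fun j => isCompact_closedBall _ _
  obtain ⟨l, -, φ, hφ, hl⟩ := hcomp.tendsto_subseq (x := fun n j => f j (y n : X))
    (fun n j _ => by
      rw [mem_closedBall_zero_iff]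
      exact ((f j).le_opNorm _).trans (by gcongr; exact hy n))
  rw [tendsto_pi_nhds] at hl
  have hex : ∀ k, ∃ p ∈ convexHull ℝ ((fun n => (x (φ n), y (φ n))) '' Set.Ici k), ‖p.1‖ < η := by
    intro k
    obtain ⟨z, hz, hzη⟩ := exists_mem_convexHull_norm_lt (E := X)
      (S := (fun n => x (φ n)) '' Set.Ici k) hη (by
        rintro ⟨g, -, hg⟩
        have h0 := (tendsto_dual_zero_of_denseRange hf hx hfx g).comp hφ.tendsto_atTop
        refine absurd (ge_of_tendsto h0 ?_) (not_le.2 hη)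
        filter_upwards [eventually_ge_atTop k] with n hn
        exact hg _ ⟨n, hn, rfl⟩)
    have himg : (fun n => x (φ n)) '' Set.Ici k =
        LinearMap.fst ℝ X Y '' ((fun n => (x (φ n), y (φ n))) '' Set.Ici k) := by
      rw [Set.image_image]; rfl
    rw [himg, ← LinearMap.image_convexHull] at hz
    obtain ⟨p, hp, rfl⟩ := hz
    exact ⟨p, hp, hzη⟩
  choose p hp hpη using hex
  have hnear : ∀ k, ‖(p k).1 - (p k).2‖ ≤ δ := by
    intro k
    have hconv : Convex ℝ ((LinearMap.fst ℝ X Y - Y.subtype ∘ₗ LinearMap.snd ℝ X Y) ⁻¹'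
        Metric.closedBall 0 δ) := (convex_closedBall 0 δ).linear_preimage _
    have := convexHull_min (by
      rintro _ ⟨n, -, rfl⟩
      simpa using hxy (φ n)) hconv (hp k)
    simpa using this
  have hu : ∀ k, ‖(p k).2‖ ≤ δ + η := fun k => by
    calc ‖((p k).2 : X)‖ = ‖(p k).1 - ((p k).1 - (p k).2)‖ := by rw [sub_sub_cancel]
      _ ≤ δ + η := by
        refine (norm_sub_le _ _).trans ?_
        linarith [hnear k, hpη k]
  refine ⟨φ, fun k => (p k).2, hu, fun g => ?_⟩
  obtain ⟨g', hg', -⟩ := exists_extension_norm_eq Y g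
  simp_rw [← hg']
  refine tendsto_dual_zero_of_denseRange hf (R := 1 + δ + (δ + η)) (fun k => ?_) (fun j => ?_) g'
  · exact (norm_sub_le (y (φ k)) _).trans (add_le_add (hy _) (hu k))
  · rw [Metric.tendsto_atTop]
    intro e he
    obtain ⟨N, hN⟩ := Metric.tendsto_atTop.1 (hl j) (e / 2) (half_pos he)
    refine ⟨N, fun k hk => ?_⟩
    have hconv : Convex ℝ (((f j).toLinearMap ∘ₗ Y.subtype ∘ₗ LinearMap.snd ℝ X Y) ⁻¹'
        Metric.ball (l j) (e / 2)) := (convex_ball _ _).linear_preimage _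
    have h1 := convexHull_min (by
      rintro _ ⟨n, hn, rfl⟩
      exact hN n (hk.trans hn)) hconv (hp k)
    have h2 := hN k hk
    rw [dist_zero_right, Submodule.coe_sub, map_sub, ← dist_eq_norm]
    calc dist (f j (y (φ k))) (f j (p k).2)
        ≤ dist (f j (y (φ k))) (l j) + dist (f j (p k).2) (l j) := dist_triangle_right ..
      _ < e / 2 + e / 2 := add_lt_add h2 h1
      _ = e := add_halves e

/-- Derivatives of a family pass to the quotient, as long as the extensions of `t` by vectors of
`W` are mapped into `H Z δ`. -/
theorem IsMetricQuotient.map_mem_iter (hπ : IsMetricQuotient Y π) {G : Set (List X)} {t : List X}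
    {W : Set X} {δ : ℝ} (hW : ∀ s ∈ weaklyNull X, ∀ᶠ i in atTop, s i ∈ W)
    (h : ∀ r, t ++ r ∈ G → (∀ x ∈ r, x ∈ W) → r.map π ∈ H Z δ) (ζ : Ordinal.{0}) :
    ∀ r, t ++ r ∈ iter (sigmaDerivative (weaklyNull X)) G ζ → (∀ x ∈ r, x ∈ W) →
      r.map π ∈ iter (sigmaDerivative (weaklyNull Z)) (H Z δ) ζ := by
  induction ζ using Ordinal.limitRecOn with
  | zero => simpa only [iter_zero] using h
  | add_one ζ ih =>
    intro r hr hrW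
    rw [iter_add_one] at hr ⊢
    obtain ⟨hr, s, hs, hrs⟩ := hr
    obtain ⟨N, hN⟩ := eventually_atTop.1 (hW s hs)
    refine ⟨ih r hr hrW, fun i => π (s (i + N)), ⟨fun i => (hπ.norm_le _).trans (hs.1 _),
      fun g => (hs.2 (g.comp π)).comp (tendsto_add_atTop_nat N)⟩, fun i => ?_⟩
    have := ih (r ++ [s (i + N)]) (by simpa using hrs (i + N)) (by
      intro x hx
      rcases List.mem_append.1 hx with hx | hx
      · exact hrW x hx
      · rw [List.mem_singleton.1 hx]
        exact hN _ (Nat.le_add_left N i))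
    simpa using this
  | limit ζ hζ ih =>
    intro r hr hrW
    rw [mem_iter_limit hζ] at hr ⊢
    exact fun θ hθ => ih θ hθ r (hr θ hθ) hrW

theorem IsMetricQuotient.exists_extension_convexHull_norm_lt (hπ : IsMetricQuotient Y π)
    {G : Set (List X)} {ε δ : ℝ} (hδ : 0 < δ) (hG : G ⊆ H X ε) {t : List X} {ζ : Ordinal.{0}}
    (hζ : iter (sigmaDerivative (weaklyNull Z)) (H Z δ) ζ = ∅)
    (ht : t ∈ iter (sigmaDerivative (weaklyNull X)) G ζ)
    {W : Set X} (hW : ∀ s ∈ weaklyNull X, ∀ᶠ i in atTop, s i ∈ W) :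
    ∃ r, t ++ r ∈ G ∧ (∀ x ∈ r, x ∈ W) ∧ ∃ x ∈ convexHull ℝ {x | x ∈ r}, ‖π x‖ < δ := by
  by_contra! hcon
  have := hπ.map_mem_iter (δ := δ) hW (fun r hr hrW => by
    refine ⟨?_, ?_⟩
    · intro z hz
      obtain ⟨x, hx, rfl⟩ := List.mem_map.1 hz
      exact (hπ.norm_le x).trans ((hG hr).1 x (List.mem_append_right t hx))
    · by_contra hno
      obtain ⟨z, hz, hzδ⟩ := exists_mem_convexHull_norm_lt (S := {z | z ∈ r.map π}) hδ hno
      have himg : {z | z ∈ r.map π} = π.toLinearMap '' {x | x ∈ r} := by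
        ext z; simp
      rw [himg, ← LinearMap.image_convexHull] at hz
      obtain ⟨x, hx, rfl⟩ := hz
      exact hzδ.not_ge (hcon r hr hrW x hx)) ζ [] (by simpa using ht) (by simp)
  simp [hζ] at this

theorem IsMetricQuotient.mem_iter_of_forall_le (hπ : IsMetricQuotient Y π)
    [TopologicalSpace.SeparableSpace (StrongDual ℝ X)] {ε : ℝ} (hε : 0 < ε) (hε1 : ε ≤ 5 / 3)
    {ζ : Ordinal.{0}} (hζ : iter (sigmaDerivative (weaklyNull Z)) (H Z (ε / 5)) ζ = ∅)
    (ξ : Ordinal.{0}) :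
    ∀ (t : List X) (v : List Y), (∀ y ∈ v, ‖y‖ ≤ 1) →
      (∀ g : StrongDual ℝ X, ‖g‖ ≤ 1 → (∀ x ∈ t, ε ≤ g x) → ∀ y ∈ v, ε / 5 ≤ g y) →
      t ∈ iter (sigmaDerivative (weaklyNull X)) (H X ε) (ζ * ξ) →
      v ∈ iter (sigmaDerivative (weaklyNull Y)) (H Y (ε / 5)) ξ := by
  have hD := isDerivationOn_sigmaDerivative (weaklyNull X)
  have hζ0 : 0 < ζ := by
    rw [pos_iff_ne_zero]
    rintro rfl
    rw [iter_zero] at hζ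
    exact (hζ ▸ nil_mem_H : [] ∈ (∅ : Set (List Z)))
  induction ξ using Ordinal.limitRecOn with
  | zero =>
    simp only [mul_zero, iter_zero]
    rintro t v hv htv ⟨-, g, hg, hgt⟩
    refine ⟨hv, g.comp Y.subtypeL, ?_, htv g hg hgt⟩
    refine ContinuousLinearMap.opNorm_le_bound _ zero_le_one fun y => ?_
    exact g.le_of_opNorm_le hg (y : X)
  | limit ξ hξ ih =>
    intro t v hv htv ht
    rw [mem_iter_limit (Ordinal.isSuccLimit_mul_right hζ0 hξ)] at ht
    exact (mem_iter_limit hξ).2 fun θ hθ => ih θ hθ t v hv htv (ht _ (by gcongr))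
  | add_one ξ ih =>
    intro t v hv htv ht
    rw [mul_add_one, hD.iter_add trivial] at ht
    rw [iter_add_one]
    set G := iter (sigmaDerivative (weaklyNull X)) (H X ε) (ζ * ξ)
    have htG : t ∈ G := by
      have := hD.iter_subset trivial (zero_le : 0 ≤ ζ) ht
      rwa [iter_zero] at this
    have hG : G ⊆ H X ε := by
      have := hD.iter_subset (L := H X ε) trivial (zero_le : 0 ≤ ζ * ξ)
      rwa [iter_zero] at this
    set f := TopologicalSpace.denseSeq (StrongDual ℝ X)
    have hf : DenseRange f := TopologicalSpace.denseRange_denseSeq _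
    have hex : ∀ n : ℕ, ∃ (r : List X) (x : X), t ++ r ∈ G ∧ x ∈ convexHull ℝ {x | x ∈ r} ∧
        (∀ j ≤ n, |f j x| ≤ 1 / ((n : ℝ) + 1)) ∧ ‖π x‖ < ε / 5 := by
      intro n
      obtain ⟨r, hr, hrW, x, hx, hxπ⟩ := hπ.exists_extension_convexHull_norm_lt
        (W := {x | ∀ j ≤ n, |f j x| ≤ 1 / ((n : ℝ) + 1)}) (by positivity) hG hζ ht (by
          intro s hs
          refine (Set.finite_Iic n).eventually_all.2 fun j _ => ?_
          have := (hs.2 (f j)).abs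
          rw [abs_zero] at this
          exact this.eventually_le_const (by positivity))
      refine ⟨r, x, hr, hx, fun j hj => ?_, hxπ⟩
      have hconv : Convex ℝ ((f j).toLinearMap ⁻¹' Metric.closedBall 0 (1 / ((n : ℝ) + 1))) :=
        (convex_closedBall _ _).linear_preimage _
      have := convexHull_min (fun x hx => by simpa using hrW x hx j hj) hconv hx
      simpa using this
    choose r x hrG hxr hfx hxπ using hex
    have hx1 : ∀ n, ‖x n‖ ≤ 1 := fun n => by
      have := convexHull_min (fun x hx => mem_closedBall_zero_iff.2
        ((hG (hrG n)).1 x (List.mem_append_right t hx))) (convex_closedBall (0 : X) 1) (hxr n)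
      rwa [mem_closedBall_zero_iff] at this
    have hlim : ∀ j, Tendsto (fun n => f j (x n)) atTop (𝓝 0) := fun j => by
      refine squeeze_zero_norm' ?_ tendsto_one_div_add_atTop_nhds_zero_nat
      filter_upwards [eventually_ge_atTop j] with n hn
      exact hfx n j hn
    have hexy : ∀ n, ∃ y : Y, ‖x n - y‖ ≤ ε / 5 := fun n => by
      obtain ⟨w, hw, hwn⟩ := hπ.exists_norm_lt (π (x n)) _ (sub_pos.2 (hxπ n))
      refine ⟨⟨x n - w, (hπ.eq_zero_iff _).1 (by rw [map_sub, hw, sub_self])⟩, ?_⟩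
      simp only [sub_sub_cancel]
      linarith
    choose y hy using hexy
    obtain ⟨φ, u, hu, hnull⟩ := exists_subseq_sub_tendsto_zero hf hx1 hlim
      (show 0 < ε / 5 by positivity) hy
    have hy1 : ∀ n, ‖y n‖ ≤ 1 + ε / 5 := fun n => by
      calc ‖(y n : X)‖ = ‖x n - (x n - y n)‖ := by rw [sub_sub_cancel]
        _ ≤ 1 + ε / 5 := (norm_sub_le _ _).trans (add_le_add (hx1 n) (hy n))
    have hs1 : ∀ k, ‖(2 : ℝ)⁻¹ • (y (φ k) - u k)‖ ≤ 1 := fun k => by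
      rw [norm_smul, Real.norm_of_nonneg (by norm_num)]
      have := (norm_sub_le (y (φ k)) (u k)).trans (add_le_add (hy1 (φ k)) (hu k))
      linarith
    refine ⟨ih t v hv htv htG, fun k => (2 : ℝ)⁻¹ • (y (φ k) - u k), ⟨hs1, fun g => ?_⟩,
      fun k => ih (t ++ r (φ k)) _ ?_ ?_ (hrG (φ k))⟩
    · simpa using (hnull g).const_mul (2 : ℝ)⁻¹
    · intro w hw
      rcases List.mem_append.1 hw with hw | hw
      · exact hv w hw
      · rw [List.mem_singleton.1 hw]
        exact hs1 k
    · intro g hg hgt w hw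
      rcases List.mem_append.1 hw with hw | hw
      · exact htv g hg (fun x hx => hgt x (List.mem_append_left _ hx)) w hw
      rw [List.mem_singleton.1 hw]
      have hconv : Convex ℝ (g.toLinearMap ⁻¹' Set.Ici ε) := (convex_Ici ε).linear_preimage _
      have h1 : ε ≤ g (x (φ k)) :=
        convexHull_min (fun x hx => hgt x (List.mem_append_right t hx)) hconv (hxr (φ k))
      have h2 : g (x (φ k) - y (φ k)) ≤ ε / 5 :=
        (le_abs_self _).trans ((g.le_of_opNorm_le hg _).trans (by rw [one_mul]; exact hy _))
      have h3 : g (u k) ≤ ε / 5 + ε / 5 :=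
        (le_abs_self _).trans ((g.le_of_opNorm_le hg _).trans (by rw [one_mul]; exact hu k))
      rw [map_sub] at h2
      simp only [Submodule.coe_smul, Submodule.coe_sub, map_smul, map_sub, smul_eq_mul]
      linarith

theorem Iw_H_le_mul (Y : Submodule ℝ X) [IsClosed (Y : Set X)]
    [TopologicalSpace.SeparableSpace (StrongDual ℝ X)] {ε : ℝ} (hε : 0 < ε) (hε1 : ε ≤ 5 / 3) :
    Iw (H X ε) ≤ Iw (H (X ⧸ Y) (ε / 5)) * Iw (H Y (ε / 5)) := by
  have hZpos : 0 < Iw (H (X ⧸ Y) (ε / 5)) := index_pos ⟨_, nil_mem_H⟩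
  have hYpos : 0 < Iw (H Y (ε / 5)) := index_pos ⟨_, nil_mem_H⟩
  rcases lt_or_ge (Iw (H (X ⧸ Y) (ε / 5))) ω₁ with hZ | hZ
  · rcases lt_or_ge (Iw (H Y (ε / 5))) ω₁ with hY | hY
    · refine index_le (mul_lt_omega_one hZ hY) (Set.eq_empty_of_forall_notMem fun t ht => ?_)
      have := (isMetricQuotient_quotientMap Y).mem_iter_of_forall_le hε hε1 (iter_index hZ) _
        t [] (by simp) (by simp) ht
      rw [Iw, iter_index hY] at this
      exact this
    · exact index_le_omega_one.trans (hY.trans (Ordinal.le_mul_right _ hZpos))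
  · exact index_le_omega_one.trans (hZ.trans (Ordinal.le_mul_left _ hYpos))

end ThreeSpaceWeaklyNull

end SzlenkIndex

theorem theorem5p11 :
    (∀ (X : Type u) [NormedAddCommGroup X] [NormedSpace ℝ X] [CompleteSpace X]
      [TopologicalSpace.SeparableSpace (StrongDual ℝ X)]
      (Y : Submodule ℝ X) [IsClosed (Y : Set X)] (ε : ℝ), 0 < ε → ε < 1 / 3 →
        SzlenkIndex.Iw (SzlenkIndex.H X ε) ≤
          SzlenkIndex.Iw (SzlenkIndex.H (X ⧸ Y) (ε / 5)) *
            SzlenkIndex.Iw (SzlenkIndex.H Y (ε / 5))) ∧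
    ∀ ξ : Ordinal.{0}, ξ < ω₁ →
      SzlenkIndex.IsThreeSpaceProperty.{u} (fun X _ _ => SzlenkIndex.Sz X ≤ ω ^ ω ^ ξ) ∧
      SzlenkIndex.IsThreeSpaceProperty.{u} (fun X _ _ => SzlenkIndex.Sz X < ω ^ ω ^ ξ) := by
  refine ⟨fun X _ _ _ _ Y _ ε hε hε1 => SzlenkIndex.Iw_H_le_mul Y hε (by linarith), fun ξ hξ => ?_⟩
  exact ⟨SzlenkIndex.isThreeSpaceProperty_Sz_le hξ, SzlenkIndex.isThreeSpaceProperty_Sz_lt hξ⟩
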